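/- For $n \times n$ complex Hermitian positive definite matrices $X, Y$, let $\delta_R(X,Y) := \|\log(Y^{-1/2} X Y^{-1/2})\|_F$, where $\|Z\|_F = \sqrt{\operatorname{tr}(Z^*Z)}$ is the Frobenius norm and $\log$ is the matrix logarithm, and let $\delta_S(X,Y) := \sqrt{S(X,Y)}$, where $$S(X,Y) := \log\det\Bigl(\frac{X+Y}{2}\Bigr) - \frac12 \log\det(XY)$$ is the symmetric Stein divergence. Real powers and logarithms of a Hermitian positive definite matrix are taken through its spectral decomposition. **Theorem.** Let $A, B$ be $n \times n$ complex Hermitian positive definite matrices, and let $t, u$ be real numbers with $1 \le t \le u < \infty$. Then $$\frac1t\,\delta_R(A^t,B^t) \le \frac1u\,\delta_R(A^u,B^u), \qquad \frac1t\,\delta_S^2(A^t,B^t) \le \frac1u\,\delta_S^2(A^u,B^u),$$ and $$\det\Bigl(\frac{A^t+B^t}{2}\Bigr)^{1/t} \le \det\Bigl(\frac{A^u+B^u}{2}\Bigr)^{1/u}.$$ -/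

import Mathlib

open scoped Matrix ComplexOrder

noncomputable section

namespace SDivergence

/-- The real power `A ^ s` of a positive definite matrix, through the functional calculus
`A = U Λ U* ↦ U (Λ ^ s) U*`. -/
def mpow {n : ℕ} (A : Matrix (Fin n) (Fin n) ℂ) (s : ℝ) : Matrix (Fin n) (Fin n) ℂ :=
  cfc (fun x : ℝ => x ^ s) A

/-- The logarithm of a positive definite matrix, `A = U Λ U* ↦ U (log Λ) U*`. -/
def mlog {n : ℕ} (A : Matrix (Fin n) (Fin n) ℂ) : Matrix (Fin n) (Fin n) ℂ :=
  cfc Real.log A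

/-- The Frobenius norm `√(tr (X* X))`; the trace is a nonnegative real number. -/
def frob {n : ℕ} (X : Matrix (Fin n) (Fin n) ℂ) : ℝ :=
  Real.sqrt (Xᴴ * X).trace.re

/-- The Riemannian distance `‖log (Y^{-1/2} X Y^{-1/2})‖_F` of positive definite matrices. -/
def deltaR {n : ℕ} (X Y : Matrix (Fin n) (Fin n) ℂ) : ℝ :=
  frob (mlog (mpow Y (-(1 / 2)) * X * mpow Y (-(1 / 2))))

/-- The symmetric Stein divergence `log det ((X + Y) / 2) - (1/2) log det (X Y)` of positive
definite matrices; both determinants are then positive real numbers, read off by `re`. -/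
def steinDiv {n : ℕ} (X Y : Matrix (Fin n) (Fin n) ℂ) : ℝ :=
  Real.log ((1 / 2 : ℂ) • (X + Y)).det.re - 1 / 2 * Real.log (X * Y).det.re

/-- `δ_S = √S`, the metric whose square is the symmetric Stein divergence. -/
def deltaS {n : ℕ} (X Y : Matrix (Fin n) (Fin n) ℂ) : ℝ :=
  Real.sqrt (steinDiv X Y)

end SDivergence

end

/-! With X = A^t, Y = B^t and r = u/t ≥ 1, each claim compares a quantity at (X, Y) with the same
quantity at (X^r, Y^r). The determinant inequality follows from operator concavity of x ↦ x^(1/r)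
and monotonicity of det in the Löwner order (`det_re_mean_rpow_le`). Its logarithm gives the Stein
inequality, as log det (XY) scales exactly by r. For the Riemannian distance, Löwner–Heinz bounds
the top eigenvalue of Y^(-1/2) X Y^(-1/2) (`conj_le_of_conj_rpow_le`). Applied to compound matrices,
whose eigenvalues are k-fold products, it bounds every such product (`prod_eigenvalues_le`). The
determinants match, so the logarithms are majorized, and sums of squares respect majorization
(`sum_sq_le_of_forall_subset`). -/

namespace SDivergence

open Matrix
open scoped MatrixOrder Matrix.Norms.L2Operator

/-! ### Unitary diagonalization, real powers and Löwner-order inequalities. -/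

section Spectral

variable {I : Type*} [Fintype I] [DecidableEq I]

/-- The matrix `V D V*`, where `D` is diagonal with real entries `d`. -/
noncomputable def conjDiag (V : Matrix I I ℂ) (d : I → ℝ) : Matrix I I ℂ :=
  V * diagonal (fun i => (d i : ℂ)) * Vᴴ

lemma conjDiag_isHermitian (V : Matrix I I ℂ) (d : I → ℝ) : (conjDiag V d).IsHermitian := by
  have h : (diagonal (fun i => (d i : ℂ)))ᴴ = diagonal (fun i => (d i : ℂ)) := by
    rw [diagonal_conjTranspose]; congr 1; ext i; simp
  simp [IsHermitian, conjDiag, Matrix.mul_assoc, h]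

lemma eq_conjDiag_eigenvalues {A : Matrix I I ℂ} (hA : A.IsHermitian) :
    A = conjDiag (hA.eigenvectorUnitary : Matrix I I ℂ) hA.eigenvalues := by
  exact hA.spectral_theorem.trans (Unitary.conjStarAlgAut_apply _ _)

/-- The unitary `Vᴴ * U` intertwines the two diagonals, so its (i, j) entry vanishes unless `l j = d
i`; hence it also intertwines their images under any `f`, continuous or not. -/
lemma conjDiag_congr {U V : Matrix I I ℂ} (hU : U ∈ unitaryGroup I ℂ) (hV : V ∈ unitaryGroup I ℂ)
    {l d : I → ℝ} (h : conjDiag V d = conjDiag U l) (f : ℝ → ℝ) :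
    conjDiag V (fun i => f (d i)) = conjDiag U (fun i => f (l i)) := by
  have hV1 : Vᴴ * V = 1 := mem_unitaryGroup_iff'.1 hV
  have hV2 : V * Vᴴ = 1 := mem_unitaryGroup_iff.1 hV
  have hU1 : Uᴴ * U = 1 := mem_unitaryGroup_iff'.1 hU
  have hU2 : U * Uᴴ = 1 := mem_unitaryGroup_iff.1 hU
  have h1 : (Vᴴ * U) * diagonal (fun i => (l i : ℂ))
      = diagonal (fun i => (d i : ℂ)) * (Vᴴ * U) := by
    have := congrArg (fun M => Vᴴ * M * U) h
    simp only [conjDiag, Matrix.mul_assoc, hU1, Matrix.mul_one] at this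
    rw [← Matrix.mul_assoc Vᴴ V, hV1, Matrix.one_mul] at this
    rw [Matrix.mul_assoc, this]
  have h2 : (Vᴴ * U) * diagonal (fun i => (f (l i) : ℂ))
      = diagonal (fun i => (f (d i) : ℂ)) * (Vᴴ * U) := by
    ext i j
    have h3 := congrFun (congrFun h1 i) j
    rw [mul_diagonal, diagonal_mul] at h3 ⊢
    by_cases hw : (Vᴴ * U) i j = 0
    · simp [hw]
    · rw [mul_comm] at h3
      have : l j = d i := by exact_mod_cast mul_right_cancel₀ hw h3
      rw [this, mul_comm]
  symm
  calc conjDiag U (fun i => f (l i))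
      = V * ((Vᴴ * U) * diagonal (fun i => (f (l i) : ℂ))) * Uᴴ := by
        simp only [conjDiag, ← Matrix.mul_assoc, hV2, Matrix.one_mul]
    _ = conjDiag V (fun i => f (d i)) := by
        rw [h2]
        simp only [conjDiag, Matrix.mul_assoc, hU2, Matrix.mul_one]

/-- Evaluates the functional calculus in any unitary diagonalization, not only the chosen
eigenbasis; powers of powers and of compounds need this. -/
lemma cfc_conjDiag {V : Matrix I I ℂ} (hV : V ∈ unitaryGroup I ℂ) (d : I → ℝ) (f : ℝ → ℝ) :
    cfc f (conjDiag V d) = conjDiag V (fun i => f (d i)) := by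
  have hA := conjDiag_isHermitian V d
  rw [conjDiag_congr hA.eigenvectorUnitary.2 hV (eq_conjDiag_eigenvalues hA) f, hA.cfc_eq,
    IsHermitian.cfc, Unitary.conjStarAlgAut_apply]
  rfl

lemma det_conjDiag {V : Matrix I I ℂ} (hV : V ∈ unitaryGroup I ℂ) (d : I → ℝ) :
    (conjDiag V d).det = ((∏ i, d i : ℝ) : ℂ) := by
  have hV2 : V * Vᴴ = 1 := mem_unitaryGroup_iff.1 hV
  rw [conjDiag, det_mul_right_comm, det_mul, hV2, det_one, one_mul, det_diagonal,
    Complex.ofReal_prod]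

lemma smul_conjDiag (c : ℝ) (V : Matrix I I ℂ) (d : I → ℝ) :
    c • conjDiag V d = conjDiag V (fun i => c * d i) := by
  have : diagonal (fun i => ((c * d i : ℝ) : ℂ)) = c • diagonal (fun i => (d i : ℂ)) := by
    ext i j
    by_cases h : i = j <;> simp [h]
  rw [conjDiag, conjDiag, this, Matrix.mul_smul, Matrix.smul_mul]

lemma rpow_eq_cfc {A : Matrix I I ℂ} (hA : A.PosDef) (s : ℝ) :
    A ^ s = cfc (fun x : ℝ => x ^ s) A :=
  CFC.rpow_eq_cfc_real (nonneg_iff_posSemidef.2 hA.posSemidef)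

lemma rpow_eq_conjDiag {A : Matrix I I ℂ} (hA : A.PosDef) (s : ℝ) :
    A ^ s = conjDiag (hA.1.eigenvectorUnitary : Matrix I I ℂ) (fun i => hA.1.eigenvalues i ^ s) := by
  rw [rpow_eq_cfc hA]
  conv_lhs => rw [eq_conjDiag_eigenvalues hA.1]
  exact cfc_conjDiag hA.1.eigenvectorUnitary.2 _ _

lemma posDef_rpow {A : Matrix I I ℂ} (hA : A.PosDef) (s : ℝ) : (A ^ s).PosDef :=
  isStrictlyPositive_iff_posDef.1 (IsStrictlyPositive.rpow A s (isStrictlyPositive_iff_posDef.2 hA))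

lemma rpow_mul {A : Matrix I I ℂ} (hA : A.PosDef) (s t : ℝ) : (A ^ s) ^ t = A ^ (s * t) := by
  rw [rpow_eq_cfc (posDef_rpow hA s), rpow_eq_conjDiag hA, rpow_eq_conjDiag hA,
    cfc_conjDiag hA.1.eigenvectorUnitary.2]
  congr 1
  ext i
  rw [Real.rpow_mul (hA.eigenvalues_pos i).le]

lemma det_re_rpow {A : Matrix I I ℂ} (hA : A.PosDef) (s : ℝ) :
    (A ^ s).det.re = A.det.re ^ s := by
  conv_rhs => rw [eq_conjDiag_eigenvalues hA.1]
  rw [rpow_eq_conjDiag hA, det_conjDiag hA.1.eigenvectorUnitary.2,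
    det_conjDiag hA.1.eigenvectorUnitary.2, Complex.ofReal_re, Complex.ofReal_re,
    Real.finsetProd_rpow _ _ fun i _ => (hA.eigenvalues_pos i).le]

lemma det_re_pos {A : Matrix I I ℂ} (hA : A.PosDef) : 0 < A.det.re :=
  (Complex.pos_iff.1 hA.det_pos).1

lemma one_le_det_re_one_add {A : Matrix I I ℂ} (hA : A.PosSemidef) : 1 ≤ (1 + A).det.re := by
  have hV2 : (hA.1.eigenvectorUnitary : Matrix I I ℂ) * (hA.1.eigenvectorUnitary : Matrix I I ℂ)ᴴ
    = 1 := mem_unitaryGroup_iff.1 hA.1.eigenvectorUnitary.2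
  have : 1 + A = conjDiag (hA.1.eigenvectorUnitary : Matrix I I ℂ) (fun i => 1 + hA.1.eigenvalues i) := by
    conv_lhs => rw [eq_conjDiag_eigenvalues hA.1, ← hV2]
    simp only [conjDiag, Complex.ofReal_add, ← diagonal_add, Matrix.mul_add, Matrix.add_mul]
    simp
  rw [this, det_conjDiag hA.1.eigenvectorUnitary.2, Complex.ofReal_re]
  calc (1 : ℝ) = ∏ _i : I, (1 : ℝ) := by simp
    _ ≤ _ := Finset.prod_le_prod (fun _ _ => zero_le_one)
      fun i _ => by linarith [hA.eigenvalues_nonneg i]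

lemma conj_rpow_neg_half {Q : Matrix I I ℂ} (hQ : Q.PosDef) :
    Q ^ (-(1 / 2) : ℝ) * Q * Q ^ (-(1 / 2) : ℝ) = 1 := by
  have hu : IsUnit Q := hQ.isUnit
  have h1 := CFC.rpow_one Q (nonneg_iff_posSemidef.2 hQ.posSemidef)
  conv_lhs => enter [1, 2]; rw [← h1]
  rw [← CFC.rpow_add hu, ← CFC.rpow_add hu]
  norm_num
  exact CFC.rpow_zero Q (nonneg_iff_posSemidef.2 hQ.posSemidef)

lemma rpow_half_mul {Q : Matrix I I ℂ} (hQ : Q.PosDef) :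
    Q ^ (1 / 2 : ℝ) * Q ^ (1 / 2 : ℝ) = Q := by
  rw [← CFC.rpow_add hQ.isUnit]
  norm_num
  exact CFC.rpow_one Q (nonneg_iff_posSemidef.2 hQ.posSemidef)

lemma rpow_half_mul_rpow_neg_half {Q : Matrix I I ℂ} (hQ : Q.PosDef) :
    Q ^ (1 / 2 : ℝ) * Q ^ (-(1 / 2) : ℝ) = 1 :=
  CFC.rpow_mul_rpow_neg _ (isStrictlyPositive_iff_posDef.2 hQ)

lemma rpow_neg_half_mul_rpow_half {Q : Matrix I I ℂ} (hQ : Q.PosDef) :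
    Q ^ (-(1 / 2) : ℝ) * Q ^ (1 / 2 : ℝ) = 1 :=
  CFC.rpow_neg_mul_rpow _ (isStrictlyPositive_iff_posDef.2 hQ)

omit [DecidableEq I] in
lemma conj_mono {A B C : Matrix I I ℂ} (hC : C.IsHermitian) (h : A ≤ B) :
    C * A * C ≤ C * B * C := by
  have := star_left_conjugate_le_conjugate h C
  rwa [star_eq_conjTranspose, hC.eq] at this

/-- Factor B = A^(1/2) (1 + P) A^(1/2) with P ≥ 0; then det (1 + P) ≥ 1. -/
lemma det_re_mono {A B : Matrix I I ℂ} (hA : A.PosDef) (h : A ≤ B) : A.det.re ≤ B.det.re := by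
  have hS := posDef_rpow hA (1 / 2)
  have hT := posDef_rpow hA (-(1 / 2))
  have hP : (A ^ (-(1 / 2) : ℝ) * (B - A) * A ^ (-(1 / 2) : ℝ)).PosSemidef := by
    have := (le_iff.1 h).mul_mul_conjTranspose_same (A ^ (-(1 / 2) : ℝ))
    rwa [hT.1.eq] at this
  have e : B = A ^ (1 / 2 : ℝ) * (1 + A ^ (-(1 / 2) : ℝ) * (B - A) * A ^ (-(1 / 2) : ℝ))
      * A ^ (1 / 2 : ℝ) := by
    have e2 : A ^ (1 / 2 : ℝ) * (A ^ (-(1 / 2) : ℝ) * (B - A) * A ^ (-(1 / 2) : ℝ))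
      * A ^ (1 / 2 : ℝ) = B - A := by
      calc _ = (A ^ (1 / 2 : ℝ) * A ^ (-(1 / 2) : ℝ)) * (B - A) *
            (A ^ (-(1 / 2) : ℝ) * A ^ (1 / 2 : ℝ)) := by simp only [Matrix.mul_assoc]
        _ = _ := by rw [rpow_half_mul_rpow_neg_half hA, rpow_neg_half_mul_rpow_half hA]; simp
    rw [Matrix.mul_add, Matrix.add_mul, e2, Matrix.mul_one, rpow_half_mul hA]
    abel
  have hd : B.det = A.det * (1 + A ^ (-(1 / 2) : ℝ) * (B - A) * A ^ (-(1 / 2) : ℝ)).det := by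
    conv_lhs => rw [e]
    conv_rhs => enter [1]; rw [← rpow_half_mul hA]
    simp only [det_mul]
    ring
  have hi : A.det.im = 0 := ((Complex.pos_iff.1 hA.det_pos).2).symm
  rw [hd, Complex.mul_re, hi, zero_mul, sub_zero]
  exact le_mul_of_one_le_right (det_re_pos hA).le (one_le_det_re_one_add hP)

/-- Operator concavity of `x ↦ x ^ (1 / r)` gives the power mean inequality for determinants. -/
lemma det_re_mean_rpow_le {A B : Matrix I I ℂ} (hA : A.PosDef) (hB : B.PosDef) {r : ℝ}
    (hr : 1 ≤ r) :
    ((1 / 2 : ℂ) • (A + B)).det.re ^ r ≤ ((1 / 2 : ℂ) • (A ^ r + B ^ r)).det.re := by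
  have hr0 : 0 < r := by linarith
  have hp : r⁻¹ ∈ Set.Icc (0 : ℝ) 1 := ⟨by positivity, inv_le_one_of_one_le₀ hr⟩
  have hAr := posDef_rpow hA r
  have hBr := posDef_rpow hB r
  have hc : (0 : ℂ) < 1 / 2 := by norm_num
  have hM : ((1 / 2 : ℂ) • (A + B)).PosDef := (hA.add hB).smul hc
  have hN : ((1 / 2 : ℂ) • (A ^ r + B ^ r)).PosDef := (hAr.add hBr).smul hc
  have key := (CFC.concaveOn_rpow (A := Matrix I I ℂ) hp).2
    (nonneg_iff_posSemidef.2 hAr.posSemidef) (nonneg_iff_posSemidef.2 hBr.posSemidef)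
    (show (0 : ℝ) ≤ 1 / 2 by norm_num) (show (0 : ℝ) ≤ 1 / 2 by norm_num) (by norm_num)
  simp only [rpow_mul hA, rpow_mul hB, mul_inv_cancel₀ hr0.ne'] at key
  rw [CFC.rpow_one A (nonneg_iff_posSemidef.2 hA.posSemidef),
    CFC.rpow_one B (nonneg_iff_posSemidef.2 hB.posSemidef), ← smul_add, ← smul_add] at key
  have hs (X : Matrix I I ℂ) : (1 / 2 : ℝ) • X = (1 / 2 : ℂ) • X := by
    ext i j; simp
  rw [hs, hs] at key
  have h := det_re_mono hM key
  rw [det_re_rpow hN] at h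
  calc _ ≤ (((1 / 2 : ℂ) • (A ^ r + B ^ r)).det.re ^ r⁻¹) ^ r :=
        Real.rpow_le_rpow (det_re_pos hM).le h hr0.le
    _ = _ := Real.rpow_inv_rpow (det_re_pos hN).le hr0.ne'

/-- Cordes' inequality in Löwner form. -/
lemma conj_le_of_conj_rpow_le {P Q : Matrix I I ℂ} (hP : P.PosDef) (hQ : Q.PosDef) {r : ℝ}
    (hr : 1 ≤ r) {c : ℝ} (hc : 0 < c)
    (h : (Q ^ r) ^ (-(1 / 2) : ℝ) * P ^ r * (Q ^ r) ^ (-(1 / 2) : ℝ) ≤ (c ^ r) • (1 : Matrix I I ℂ)) :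
    Q ^ (-(1 / 2) : ℝ) * P * Q ^ (-(1 / 2) : ℝ) ≤ c • (1 : Matrix I I ℂ) := by
  have hr0 : 0 < r := by linarith
  have hp : r⁻¹ ∈ Set.Icc (0 : ℝ) 1 := ⟨by positivity, inv_le_one_of_one_le₀ hr⟩
  have hPr := posDef_rpow hP r
  have hQr := posDef_rpow hQ r
  have h1 : P ^ r ≤ (c ^ r) • Q ^ r := by
    have := conj_mono (posDef_rpow hQr (1 / 2)).1 h
    rw [Matrix.mul_smul, Matrix.smul_mul, Matrix.mul_one, rpow_half_mul hQr] at this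
    convert this using 1
    calc P ^ r = ((Q ^ r) ^ (1 / 2 : ℝ) * (Q ^ r) ^ (-(1 / 2) : ℝ)) * P ^ r *
            ((Q ^ r) ^ (-(1 / 2) : ℝ) * (Q ^ r) ^ (1 / 2 : ℝ)) := by
          rw [rpow_half_mul_rpow_neg_half hQr, rpow_neg_half_mul_rpow_half hQr]; simp
      _ = _ := by simp only [Matrix.mul_assoc]
  -- Absorbing the scalar makes both sides r-th powers, so that Löwner–Heinz with exponent 1/r ≤ 1
  -- removes them.
  have e : (c ^ r) • Q ^ r = (c • Q) ^ r := by
    rw [rpow_eq_cfc (hQ.smul hc), rpow_eq_conjDiag hQ, smul_conjDiag]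
    conv_rhs => rw [eq_conjDiag_eigenvalues hQ.1, smul_conjDiag]
    rw [cfc_conjDiag hQ.1.eigenvectorUnitary.2]
    congr 1
    ext i
    rw [Real.mul_rpow hc.le (hQ.eigenvalues_pos i).le]
  rw [e] at h1
  have hcQ : (c • Q).PosDef := hQ.smul hc
  have h2 := CFC.rpow_le_rpow hp h1
  rw [rpow_mul hP, rpow_mul hcQ, mul_inv_cancel₀ hr0.ne',
    CFC.rpow_one P (nonneg_iff_posSemidef.2 hP.posSemidef),
    CFC.rpow_one _ (nonneg_iff_posSemidef.2 hcQ.posSemidef)] at h2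
  have := conj_mono (posDef_rpow hQ (-(1 / 2))).1 h2
  rwa [Matrix.mul_smul, Matrix.smul_mul, conj_rpow_neg_half hQ] at this

end Spectral

end SDivergence

namespace SDivergence

open Matrix
open scoped MatrixOrder Matrix.Norms.L2Operator

/-! ### Compound matrices and log-majorization. -/

section Compound

open Set Set.powersetCard

variable {I : Type*} [Fintype I] [LinearOrder I]

/-- The `k`-th compound matrix, the matrix of the `k`-th exterior power in the standard basis. -/
noncomputable def compound (k : ℕ) (A : Matrix I I ℂ) :
    Matrix (powersetCard I k) (powersetCard I k) ℂ :=
  LinearMap.toMatrix ((Pi.basisFun ℂ I).exteriorPower k) ((Pi.basisFun ℂ I).exteriorPower k)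
    (exteriorPower.map k (Matrix.toLin' A))

lemma compound_apply (k : ℕ) (A : Matrix I I ℂ) (s t : powersetCard I k) :
    compound k A s t = (A.submatrix (ofFinEmbEquiv.symm s) (ofFinEmbEquiv.symm t)).det := by
  rw [compound, LinearMap.toMatrix_apply, exteriorPower.basis_repr_apply,
    exteriorPower.basis_apply, exteriorPower.map_apply_ιMulti_family,
    exteriorPower.ιMulti_family, exteriorPower.ιMultiDual_apply_ιMulti, ← det_transpose]
  congr 1
  ext i j
  simp

/-- Cauchy–Binet, obtained from functoriality of the exterior power. -/
lemma compound_mul (k : ℕ) (A B : Matrix I I ℂ) :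
    compound k (A * B) = compound k A * compound k B := by
  rw [compound, Matrix.toLin'_mul, exteriorPower.map_comp,
    LinearMap.toMatrix_comp _ ((Pi.basisFun ℂ I).exteriorPower k)]
  rfl

lemma compound_one (k : ℕ) : compound k (1 : Matrix I I ℂ) = 1 := by
  rw [compound, Matrix.toLin'_one, exteriorPower.map_id, LinearMap.toMatrix_id]

lemma compound_conjTranspose (k : ℕ) (A : Matrix I I ℂ) :
    compound k Aᴴ = (compound k A)ᴴ := by
  ext s t
  rw [conjTranspose_apply, compound_apply, compound_apply, ← det_conjTranspose]
  rfl

lemma compound_diagonal (k : ℕ) (d : I → ℂ) :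
    compound k (diagonal d) = diagonal (fun s : powersetCard I k => ∏ i ∈ s.val, d i) := by
  ext s t
  rw [compound_apply]
  by_cases h : s = t
  · subst h
    rw [submatrix_diagonal _ _ (ofFinEmbEquiv.symm s).injective, det_diagonal, diagonal_apply_eq,
      ofFinEmbEquiv_symm_apply]
    conv_rhs => rw [← Finset.map_orderEmbOfFin_univ s.val s.prop, Finset.prod_map]
    rfl
  · rw [diagonal_apply_ne _ h]
    -- An index in `s` but not in `t` gives a zero row of the minor.
    obtain ⟨i, his, hit⟩ := (exists_mem_notMem_iff_ne s t).mp h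
    obtain ⟨j, rfl⟩ := (mem_range_ofFinEmbEquiv_symm_iff_mem s i).mpr his
    apply det_eq_zero_of_row_eq_zero j
    intro l
    rw [submatrix_apply, diagonal_apply_ne]
    intro e
    exact hit (e ▸ (mem_range_ofFinEmbEquiv_symm_iff_mem t _).mp ⟨l, rfl⟩)

lemma compound_mem_unitaryGroup (k : ℕ) {V : Matrix I I ℂ} (hV : V ∈ unitaryGroup I ℂ) :
    compound k V ∈ unitaryGroup (powersetCard I k) ℂ := by
  rw [mem_unitaryGroup_iff, star_eq_conjTranspose, ← compound_conjTranspose, ← compound_mul,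
    ← star_eq_conjTranspose, mem_unitaryGroup_iff.1 hV, compound_one]

lemma compound_conjDiag (k : ℕ) (V : Matrix I I ℂ) (d : I → ℝ) :
    compound k (conjDiag V d)
      = conjDiag (compound k V) (fun s : powersetCard I k => ∏ i ∈ s.val, d i) := by
  simp only [conjDiag, compound_mul, compound_conjTranspose, compound_diagonal,
    Complex.ofReal_prod]

lemma posDef_conjDiag {J : Type*} [Fintype J] [DecidableEq J] {V : Matrix J J ℂ}
    (hV : V ∈ unitaryGroup J ℂ) {d : J → ℝ} (hd : ∀ i, 0 < d i) : (conjDiag V d).PosDef := by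
  have hD : (diagonal (fun i => (d i : ℂ))).PosDef :=
    posDef_diagonal_iff.2 fun i => by exact_mod_cast hd i
  have hu : IsUnit V := IsUnit.of_mul_eq_one _ (mem_unitaryGroup_iff.1 hV)
  exact hu.posDef_star_right_conjugate_iff.2 hD

lemma posDef_compound (k : ℕ) {A : Matrix I I ℂ} (hA : A.PosDef) : (compound k A).PosDef := by
  rw [eq_conjDiag_eigenvalues hA.1, compound_conjDiag]
  exact posDef_conjDiag (compound_mem_unitaryGroup k hA.1.eigenvectorUnitary.2)
    fun s => Finset.prod_pos fun i _ => hA.eigenvalues_pos i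

lemma compound_rpow (k : ℕ) {A : Matrix I I ℂ} (hA : A.PosDef) (s : ℝ) :
    compound k (A ^ s) = compound k A ^ s := by
  rw [rpow_eq_cfc (posDef_compound k hA), rpow_eq_conjDiag hA]
  conv_rhs => rw [eq_conjDiag_eigenvalues hA.1]
  rw [compound_conjDiag, compound_conjDiag,
    cfc_conjDiag (compound_mem_unitaryGroup k hA.1.eigenvectorUnitary.2)]
  congr 1
  ext t
  rw [Real.finsetProd_rpow _ _ fun i _ => (hA.eigenvalues_pos i).le]

lemma conjDiag_le_smul_one_iff {J : Type*} [Fintype J] [DecidableEq J] {V : Matrix J J ℂ}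
    (hV : V ∈ unitaryGroup J ℂ) {d : J → ℝ} {c : ℝ} :
    conjDiag V d ≤ c • (1 : Matrix J J ℂ) ↔ ∀ i, d i ≤ c := by
  have hu : IsUnit V := IsUnit.of_mul_eq_one _ (mem_unitaryGroup_iff.1 hV)
  have hV2 : V * Vᴴ = 1 := mem_unitaryGroup_iff.1 hV
  have e : c • (1 : Matrix J J ℂ) - conjDiag V d
      = V * diagonal (fun i => ((c - d i : ℝ) : ℂ)) * star V := by
    have : diagonal (fun i => ((c - d i : ℝ) : ℂ))
        = c • (1 : Matrix J J ℂ) - diagonal (fun i => (d i : ℂ)) := by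
      ext i j
      by_cases h : i = j <;> simp [h]
    rw [this, conjDiag, star_eq_conjTranspose, Matrix.mul_sub, Matrix.sub_mul, Matrix.mul_smul,
      Matrix.smul_mul, Matrix.mul_one, hV2]
  rw [le_iff, e, hu.posSemidef_star_right_conjugate_iff, posSemidef_diagonal_iff]
  refine forall_congr' fun i => ?_
  rw [Complex.zero_le_real, sub_nonneg]

/-- Araki's log-majorization, in terms of products over sets of eigenvalues. -/
lemma prod_eigenvalues_le {A B : Matrix I I ℂ} (hA : A.PosDef) (hB : B.PosDef) {r : ℝ}
    (hr : 1 ≤ r) {V W : Matrix I I ℂ} (hV : V ∈ unitaryGroup I ℂ) (hW : W ∈ unitaryGroup I ℂ)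
    {d e : I → ℝ} (hd : B ^ (-(1 / 2) : ℝ) * A * B ^ (-(1 / 2) : ℝ) = conjDiag V d)
    (he : (B ^ r) ^ (-(1 / 2) : ℝ) * A ^ r * (B ^ r) ^ (-(1 / 2) : ℝ) = conjDiag W e)
    {c : ℝ} (hc : 0 < c) {k : ℕ} (h : ∀ s : Finset I, s.card = k → ∏ i ∈ s, e i ≤ c ^ r)
    (s : Finset I) (hs : s.card = k) : ∏ i ∈ s, d i ≤ c := by
  have h1 := congrArg (compound k) hd
  have h2 := congrArg (compound k) he
  simp only [compound_mul, compound_conjDiag, compound_rpow k hA, compound_rpow k hB,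
    compound_rpow k (posDef_rpow hB r)] at h1 h2
  -- A bound on all k-fold products is a Löwner bound on the k-th compound, where Cordes' inequality
  -- applies.
  have h3 := conj_le_of_conj_rpow_le (posDef_compound k hA) (posDef_compound k hB) hr hc (by
    rw [h2, conjDiag_le_smul_one_iff (compound_mem_unitaryGroup k hW)]
    exact fun t => h t.1 t.2)
  rw [h1, conjDiag_le_smul_one_iff (compound_mem_unitaryGroup k hV)] at h3
  exact h3 ⟨s, hs⟩

end Compound

end SDivergence

namespace SDivergence

open Matrix

/-! ### Majorization and sums of squares. -/

section Majorization

/-- Abel summation against an antitone weight. -/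
lemma le_sum_mul_of_antitone {n : ℕ} (a c : Fin (n + 1) → ℝ) (ha : Antitone a)
    (hc : ∀ k ≤ n + 1, 0 ≤ ∑ i with i.val < k, c i) :
    a (Fin.last n) * ∑ i, c i ≤ ∑ i, a i * c i := by
  induction n with
  | zero => simp
  | succ n ih =>
    rw [Fin.sum_univ_castSucc, Fin.sum_univ_castSucc (fun i => a i * c i)]
    have key (k : ℕ) (hk : k ≤ n + 1) : ∑ i : Fin (n + 1) with i.val < k, c i.castSucc
        = ∑ i : Fin (n + 2) with i.val < k, c i := by
      rw [Finset.sum_filter, Finset.sum_filter,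
        Fin.sum_univ_castSucc (n := n + 1)]
      simp [show ¬ (n + 1 < k) by omega]
    have h1 := ih (fun i => a i.castSucc) (fun i => c i.castSucc)
      (fun i j hij => ha (by simpa using hij)) (fun k hk => by
        rw [key k hk]; exact hc k (by omega))
    have h2 : 0 ≤ ∑ i : Fin (n + 1), c i.castSucc := by
      have := hc (n + 1) (by omega)
      rwa [← key (n + 1) le_rfl, Finset.filter_true_of_mem fun i _ => i.2] at this
    have h3 : a (Fin.last (n + 1)) ≤ a (Fin.last n).castSucc := ha (Fin.le_last _)
    nlinarith [mul_le_mul_of_nonneg_right h3 h2]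

lemma sum_sq_le_of_partial_sums_le {n : ℕ} (a b : Fin n → ℝ) (ha : Antitone a)
    (hab : ∀ k ≤ n, ∑ i with i.val < k, a i ≤ ∑ i with i.val < k, b i)
    (hsum : ∑ i, a i = ∑ i, b i) : ∑ i, a i ^ 2 ≤ ∑ i, b i ^ 2 := by
  cases n with
  | zero => simp
  | succ n =>
    have h := le_sum_mul_of_antitone a (fun i => b i - a i) ha (fun k hk => by
      rw [Finset.sum_sub_distrib]; linarith [hab k hk])
    rw [Finset.sum_sub_distrib, hsum, sub_self, mul_zero] at h
    have h2 : 0 ≤ ∑ i, (b i - a i) ^ 2 := Finset.sum_nonneg fun i _ => sq_nonneg _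
    -- Expanding the square about `a`: the linear term is nonnegative by Abel summation.
    have h3 : ∑ i, b i ^ 2 = ∑ i, a i ^ 2 + 2 * ∑ i, a i * (b i - a i) + ∑ i, (b i - a i) ^ 2 := by
      rw [Finset.mul_sum, ← Finset.sum_add_distrib, ← Finset.sum_add_distrib]
      exact Finset.sum_congr rfl fun i _ => by ring
    linarith

lemma sum_le_sum_initial_of_antitone {n : ℕ} (b : Fin n → ℝ) (hb : Antitone b) (k : ℕ) (hk : k ≤ n)
    (s : Finset (Fin n)) (hs : s.card = k) : ∑ i ∈ s, b i ≤ ∑ i with i.val < k, b i := by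
  have h1 : ∑ i ∈ s, b i = ∑ j : Fin k, b (s.orderEmbOfFin hs j) := by
    conv_lhs => rw [← Finset.map_orderEmbOfFin_univ s hs, Finset.sum_map]
    rfl
  have h2 : ∑ i : Fin n with i.val < k, b i = ∑ j : Fin k, b (Fin.castLE hk j) := by
    have : (Finset.univ.filter fun i : Fin n => i.val < k)
        = Finset.univ.map (Fin.castLEEmb hk) := by
      ext i
      simp only [Finset.mem_filter, Finset.mem_univ, true_and, Finset.mem_map, Fin.castLEEmb_apply]
      exact ⟨fun h => ⟨⟨i, h⟩, rfl⟩, fun ⟨j, hj⟩ => hj ▸ j.2⟩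
    rw [this, Finset.sum_map]
    rfl
  rw [h1, h2]
  refine Finset.sum_le_sum fun j _ => hb ?_
  -- The m-th smallest element of `s` is at least m.
  have key (m : ℕ) (hm : m < k) : m ≤ (s.orderEmbOfFin hs ⟨m, hm⟩).val := by
    induction m with
    | zero => exact Nat.zero_le _
    | succ m ih =>
      have h3 := ih (by omega)
      have h4 : s.orderEmbOfFin hs ⟨m, by omega⟩ < s.orderEmbOfFin hs ⟨m + 1, hm⟩ :=
        (s.orderEmbOfFin hs).strictMono (by simp)
      have := Fin.lt_def.1 h4
      omega
  exact key j j.2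

/-- Majorization, stated through arbitrary subsets of indices, implies the inequality between
sums of squares. -/
lemma sum_sq_le_of_forall_subset {n : ℕ} (a b : Fin n → ℝ)
    (hab : ∀ (k : ℕ) (m : ℝ), (∀ s : Finset (Fin n), s.card = k → ∑ i ∈ s, b i ≤ m) →
      ∀ s : Finset (Fin n), s.card = k → ∑ i ∈ s, a i ≤ m)
    (hsum : ∑ i, a i = ∑ i, b i) : ∑ i, a i ^ 2 ≤ ∑ i, b i ^ 2 := by
  have hex (f : Fin n → ℝ) : ∃ σ : Equiv.Perm (Fin n), Antitone (f ∘ σ) :=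
    ⟨Tuple.sort (fun i => -f i), fun i j hij => by
      have := Tuple.monotone_sort (fun i => -f i) hij
      simpa using this⟩
  obtain ⟨σ, hσ⟩ := hex a
  obtain ⟨τ, hτ⟩ := hex b
  have hcard (k : ℕ) (hk : k ≤ n) : (Finset.univ.filter fun i : Fin n => i.val < k).card = k := by
    rw [Fin.card_filter_val_lt, min_eq_right hk]
  have h := sum_sq_le_of_partial_sums_le (a ∘ σ) (b ∘ τ) hσ (fun k hk => by
    -- Take for `m` the sum of the k largest values of `b`, which bounds every k-subset sum.
    have := hab k (∑ i with i.val < k, (b ∘ τ) i) (fun s hs => by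
      have := sum_le_sum_initial_of_antitone (b ∘ τ) hτ k hk (s.map τ.symm.toEmbedding) (by simpa)
      simpa using this) ((Finset.univ.filter fun i : Fin n => i.val < k).map σ.toEmbedding)
      (by rw [Finset.card_map, hcard k hk])
    simpa using this) (by
      simpa [Equiv.sum_comp σ a, Equiv.sum_comp τ b] using hsum)
  simpa [Equiv.sum_comp σ (fun i => a i ^ 2), Equiv.sum_comp τ (fun i => b i ^ 2)] using h

end Majorization

/-! ### The three inequalities for X, Y and their r-th powers. -/

section Main

open scoped MatrixOrder Matrix.Norms.L2Operator

variable {n : ℕ}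

lemma mpow_eq_rpow {A : Matrix (Fin n) (Fin n) ℂ} (hA : A.PosDef) (s : ℝ) : mpow A s = A ^ s :=
  (rpow_eq_cfc hA s).symm

lemma det_re_mul {A : Matrix (Fin n) (Fin n) ℂ} (hA : A.PosDef) (B : Matrix (Fin n) (Fin n) ℂ) :
    (A * B).det.re = A.det.re * B.det.re := by
  rw [det_mul, Complex.mul_re, ← (Complex.pos_iff.1 hA.det_pos).2]
  simp

lemma frob_mlog_conjDiag {V : Matrix (Fin n) (Fin n) ℂ} (hV : V ∈ unitaryGroup (Fin n) ℂ)
    (d : Fin n → ℝ) : frob (mlog (conjDiag V d)) = Real.sqrt (∑ i, Real.log (d i) ^ 2) := by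
  have hV1 : Vᴴ * V = 1 := mem_unitaryGroup_iff'.1 hV
  rw [frob, mlog, cfc_conjDiag hV, (conjDiag_isHermitian V _).eq]
  have : conjDiag V (fun i => Real.log (d i)) * conjDiag V (fun i => Real.log (d i))
      = V * (diagonal (fun i => ((Real.log (d i) ^ 2 : ℝ) : ℂ)) * Vᴴ) := by
    simp only [conjDiag, Matrix.mul_assoc]
    rw [← Matrix.mul_assoc Vᴴ V, hV1, Matrix.one_mul, ← Matrix.mul_assoc (diagonal _) (diagonal _),
      diagonal_mul_diagonal]
    simp [sq]
  rw [this, trace_mul_comm, Matrix.mul_assoc, hV1, Matrix.mul_one, trace_diagonal,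
    ← Complex.ofReal_sum, Complex.ofReal_re]

lemma deltaR_eq_frob {X Y : Matrix (Fin n) (Fin n) ℂ} (hY : Y.PosDef) :
    deltaR X Y = frob (mlog (Y ^ (-(1 / 2) : ℝ) * X * Y ^ (-(1 / 2) : ℝ))) := by
  rw [deltaR, mpow_eq_rpow hY]

lemma posDef_conj_rpow {X Y : Matrix (Fin n) (Fin n) ℂ} (hX : X.PosDef) (hY : Y.PosDef) (s : ℝ) :
    (Y ^ s * X * Y ^ s).PosDef := by
  have h := posDef_rpow hY s
  have := h.isUnit.posDef_star_right_conjugate_iff.2 hX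
  rwa [star_eq_conjTranspose, h.1.eq] at this

lemma mul_deltaR_le {X Y : Matrix (Fin n) (Fin n) ℂ} (hX : X.PosDef) (hY : Y.PosDef) {r : ℝ}
    (hr : 1 ≤ r) : r * deltaR X Y ≤ deltaR (X ^ r) (Y ^ r) := by
  have hr0 : 0 < r := by linarith
  have hXr := posDef_rpow hX r
  have hYr := posDef_rpow hY r
  rw [deltaR_eq_frob hY, deltaR_eq_frob hYr]
  have hZ := posDef_conj_rpow hX hY (-(1 / 2))
  have hZ' := posDef_conj_rpow hXr hYr (-(1 / 2))
  have hd := eq_conjDiag_eigenvalues hZ.1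
  have he := eq_conjDiag_eigenvalues hZ'.1
  have hd0 := hZ.eigenvalues_pos
  have he0 := hZ'.eigenvalues_pos
  set d := hZ.1.eigenvalues
  set e := hZ'.1.eigenvalues
  have hV := hZ.1.eigenvectorUnitary.2
  have hW := hZ'.1.eigenvectorUnitary.2
  set V := (hZ.1.eigenvectorUnitary : Matrix (Fin n) (Fin n) ℂ)
  set W := (hZ'.1.eigenvectorUnitary : Matrix (Fin n) (Fin n) ℂ)
  clear_value d e V W
  -- Both sides equal (det X / det Y)^r; this gives the equality of total sums in the majorization.
  have hprod : ∏ i, e i = (∏ i, d i) ^ r := by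
    have h1 := congrArg (fun M => M.det.re) hd
    have h2 := congrArg (fun M => M.det.re) he
    simp only [Matrix.mul_assoc, det_re_mul (posDef_rpow hY _), det_re_mul (posDef_rpow hYr _),
      det_re_mul hX, det_re_mul hXr, det_re_rpow hX, det_re_rpow hY, det_re_rpow hYr,
      det_conjDiag hV, det_conjDiag hW, Complex.ofReal_re] at h1 h2
    have hx := det_re_pos hX
    have hy := det_re_pos hY
    rw [← h1, ← h2, Real.mul_rpow (by positivity) (by positivity),
      Real.mul_rpow (by positivity) (by positivity), ← Real.rpow_mul hy.le, ← Real.rpow_mul hy.le,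
      mul_comm r]
  have hlogs {f : Fin n → ℝ} (hf : ∀ i, 0 < f i) (s : Finset (Fin n)) :
      Real.log (∏ i ∈ s, f i) = ∑ i ∈ s, Real.log (f i) :=
    Real.log_prod fun i _ => (hf i).ne'
  have hpos {f : Fin n → ℝ} (hf : ∀ i, 0 < f i) (s : Finset (Fin n)) : 0 < ∏ i ∈ s, f i :=
    Finset.prod_pos fun i _ => hf i
  have hsq := sum_sq_le_of_forall_subset (fun i => r * Real.log (d i)) (fun i => Real.log (e i))
    (fun k m hm s hs => by
      -- The constant c = exp (m / r) satisfies c^r = exp m.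
      have h1 := prod_eigenvalues_le hX hY hr hV hW hd he (Real.exp_pos (m / r)) (k := k)
        (fun t ht => by
          rw [← Real.exp_mul, div_mul_cancel₀ _ hr0.ne', ← Real.log_le_iff_le_exp (hpos he0 t),
            hlogs he0]
          exact hm t ht) s hs
      rw [← Real.log_le_iff_le_exp (hpos hd0 s), hlogs hd0, le_div_iff₀' hr0, Finset.mul_sum] at h1
      exact h1)
    (by rw [← Finset.mul_sum, ← hlogs hd0, ← hlogs he0, hprod, Real.log_rpow (hpos hd0 _)])
  rw [hd, he, frob_mlog_conjDiag hV, frob_mlog_conjDiag hW]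
  calc r * Real.sqrt (∑ i, Real.log (d i) ^ 2)
      = Real.sqrt (∑ i, (r * Real.log (d i)) ^ 2) := by
        simp only [mul_pow, ← Finset.mul_sum]
        rw [Real.sqrt_mul (sq_nonneg r), Real.sqrt_sq hr0.le]
    _ ≤ _ := Real.sqrt_le_sqrt hsq

lemma log_det_mul_rpow {X Y : Matrix (Fin n) (Fin n) ℂ} (hX : X.PosDef) (hY : Y.PosDef) (r : ℝ) :
    Real.log (X ^ r * Y ^ r).det.re = r * Real.log (X * Y).det.re := by
  rw [det_re_mul (posDef_rpow hX r), det_re_mul hX, det_re_rpow hX, det_re_rpow hY,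
    ← Real.mul_rpow (det_re_pos hX).le (det_re_pos hY).le,
    Real.log_rpow (mul_pos (det_re_pos hX) (det_re_pos hY))]

lemma posDef_mean {X Y : Matrix (Fin n) (Fin n) ℂ} (hX : X.PosDef) (hY : Y.PosDef) :
    ((1 / 2 : ℂ) • (X + Y)).PosDef :=
  (hX.add hY).smul (by norm_num)

lemma mul_steinDiv_le {X Y : Matrix (Fin n) (Fin n) ℂ} (hX : X.PosDef) (hY : Y.PosDef) {r : ℝ}
    (hr : 1 ≤ r) : r * steinDiv X Y ≤ steinDiv (X ^ r) (Y ^ r) := by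
  have h0 := det_re_pos (posDef_mean hX hY)
  have h1 := Real.log_le_log (Real.rpow_pos_of_pos h0 r) (det_re_mean_rpow_le hX hY hr)
  rw [Real.log_rpow h0] at h1
  rw [steinDiv, steinDiv, log_det_mul_rpow hX hY]
  linarith

lemma mul_deltaS_sq_le {X Y : Matrix (Fin n) (Fin n) ℂ} (hX : X.PosDef) (hY : Y.PosDef) {r : ℝ}
    (hr : 1 ≤ r) : r * deltaS X Y ^ 2 ≤ deltaS (X ^ r) (Y ^ r) ^ 2 := by
  have hr0 : 0 < r := by linarith
  -- Pulling `r` inside the root avoids proving S ≥ 0: the squared real root is monotone even where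
  -- the root truncates to 0.
  have h : r * deltaS X Y ^ 2 = Real.sqrt (r * steinDiv X Y) ^ 2 := by
    rw [Real.sqrt_mul hr0.le, mul_pow, Real.sq_sqrt hr0.le, deltaS]
  rw [h, deltaS]
  gcongr
  exact mul_steinDiv_le hX hY hr

end Main

end SDivergence

open scoped MatrixOrder Matrix.Norms.L2Operator in
theorem SDivergence.mpow_scaling {n : ℕ} {A B : Matrix (Fin n) (Fin n) ℂ} (hA : A.PosDef)
    (hB : B.PosDef) {t u : ℝ} (ht : 1 ≤ t) (htu : t ≤ u) :
    1 / t * SDivergence.deltaR (SDivergence.mpow A t) (SDivergence.mpow B t)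
        ≤ 1 / u * SDivergence.deltaR (SDivergence.mpow A u) (SDivergence.mpow B u) ∧
    1 / t * SDivergence.deltaS (SDivergence.mpow A t) (SDivergence.mpow B t) ^ 2
        ≤ 1 / u * SDivergence.deltaS (SDivergence.mpow A u) (SDivergence.mpow B u) ^ 2 ∧
    ((1 / 2 : ℂ) • (SDivergence.mpow A t + SDivergence.mpow B t)).det.re ^ (1 / t)
        ≤ ((1 / 2 : ℂ) • (SDivergence.mpow A u + SDivergence.mpow B u)).det.re ^ (1 / u) := by
  have ht0 : 0 < t := by linarith
  have hu0 : 0 < u := by linarith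
  have hr : 1 ≤ u / t := (one_le_div ht0).2 htu
  have hX := SDivergence.posDef_rpow hA t
  have hY := SDivergence.posDef_rpow hB t
  have htr : t * (u / t) = u := by field_simp
  have hAu : A ^ u = (A ^ t) ^ (u / t) := by rw [SDivergence.rpow_mul hA, htr]
  have hBu : B ^ u = (B ^ t) ^ (u / t) := by rw [SDivergence.rpow_mul hB, htr]
  have scale {x y : ℝ} (h : u / t * x ≤ y) : 1 / t * x ≤ 1 / u * y := by
    rw [one_div_mul_eq_div, one_div_mul_eq_div, div_le_div_iff₀ ht0 hu0]
    rw [div_mul_eq_mul_div, div_le_iff₀ ht0] at h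
    linarith
  simp only [SDivergence.mpow_eq_rpow hA, SDivergence.mpow_eq_rpow hB]
  rw [hAu, hBu]
  refine ⟨scale (SDivergence.mul_deltaR_le hX hY hr), scale (SDivergence.mul_deltaS_sq_le hX hY hr),
    ?_⟩
  have h0 := (SDivergence.det_re_pos (SDivergence.posDef_mean hX hY)).le
  have h := Real.rpow_le_rpow (Real.rpow_nonneg h0 _) (SDivergence.det_re_mean_rpow_le hX hY hr)
    (show 0 ≤ 1 / u by positivity)
  rwa [← Real.rpow_mul h0, show u / t * (1 / u) = 1 / t by field_simp] at h

theorem mainTheorem3 {n : ℕ} (A B : Matrix (Fin n) (Fin n) ℂ) (hA : A.PosDef) (hB : B.PosDef)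
    (t u : ℝ) (ht : 1 ≤ t) (htu : t ≤ u) :
    1 / t * SDivergence.deltaR (SDivergence.mpow A t) (SDivergence.mpow B t)
        ≤ 1 / u * SDivergence.deltaR (SDivergence.mpow A u) (SDivergence.mpow B u) ∧
    1 / t * SDivergence.deltaS (SDivergence.mpow A t) (SDivergence.mpow B t) ^ 2
        ≤ 1 / u * SDivergence.deltaS (SDivergence.mpow A u) (SDivergence.mpow B u) ^ 2 ∧
    ((1 / 2 : ℂ) • (SDivergence.mpow A t + SDivergence.mpow B t)).det.re ^ (1 / t)
        ≤ ((1 / 2 : ℂ) • (SDivergence.mpow A u + SDivergence.mpow B u)).det.re ^ (1 / u) := by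
  exact SDivergence.mpow_scaling hA hB ht htu
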